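/- **The base category.** Let $\mathbb{C}$ be the category generated by the following graph and relations. *Vertices:* $\star$ (channels); $[n]$ for $n\in\mathbb N$ (players knowing $n$ channels); basic moves $\heartsuit_n$ (tick), $\pi^l_n,\pi^r_n$ (left and right half-forking), $\nu_n$ (channel creation) for $n\in\mathbb N$, and $\iota^+_{n,i},\iota^-_{n,i}$ (output and input on channel $i$) for $1\le i\le n$; forking $\pi_n$ for $n\in\mathbb N$; synchronisation $\tau_{n,i,m,j}$ for $1\le i\le n$, $1\le j\le m$. *Edges:* $d_i\colon\star\to[n]$ for $1\le i\le n$; for each basic move $b$ on $n$ channels, $s\colon[n]\to b$ and $t\colon[n']\to b$, where $n'=n+1$ if $b=\nu_n$ and $n'=n$ otherwise; $l\colon\pi^l_n\to\pi_n$ and $r\colon\pi^r_n\to\pi_n$; $\epsilon\colon\iota^+_{n,i}\to\tau_{n,i,m,j}$ and $\rho\colon\iota^-_{m,j}\to\tau_{n,i,m,j}$. *Relations:* $s\circ d_i=t\circ d_i$ for $1\le i\le n$ (for every basic move on $n$ channels); $l\circ s=r\circ s$; $\epsilon\circ s\circ d_i=\rho\circ s\circ d_j$ (into $\tau_{n,i,m,j}$).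 Let $\widehat{\mathbb C}$ be the category of presheaves of sets on $\mathbb C$; an object of $\mathbb C$ is identified with its representable presheaf. A *position* is a finite presheaf that is empty except over $\star$ and the $[n]$. **Moves.** A *basic move* $[n]\to[n']$ is a cospan $[n]\to M\leftarrow[n']$ in $\widehat{\mathbb C}$ which is isomorphic, as a cospan, to $[m]\xrightarrow{s}b\xleftarrow{t}[m']$ for some basic move vertex $b$ with its two edges. Let $\mathcal M_n$ be the set of isomorphism classes (as cospans) of basic moves $M\colon[n]\to[n']$, $n'$ arbitrary, and write $\mathrm{cod}(M)=n'$. For a basic move vertex $b$ on $n$ channels, its interface consists of the $n$-fold coproduct $n\cdot\star$ with the maps $[d_1,\dots,d_n]$ to $[n]$ and to $[n']$. An *extended basic move* is a cospan $X'\to M'\leftarrow Y'$ obtained from some $[n]\xrightarrow{s}b\xleftarrow{t}[n']$ by pushing out $[n]$, $b$ and $[n']$ under $n\cdot\star$ along a morphism $n\cdot\star\to Z$ to some position $Z$. **Views and strategies.** A *view* is a monomorphism $Y\hookrightarrow U$ in $\widehat{\mathbb C}$ isomorphic, as an arrow, to the initial leg $[n]\to V$ of a finite, possibly empty, composite of extended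 basic moves (composition of cospans by pushout) starting at some $[n]$. For $X\in\widehat{\mathbb C}$, let $\mathbb V_X$ be the category whose objects are spans $U\hookleftarrow Y\to X$ in which $Y\hookrightarrow U$ is a view, and whose morphisms $(U\hookleftarrow Y\to X)\to(U'\hookleftarrow Y'\to X)$ are pairs $(h\colon Y\to Y',\,k\colon U\to U')$ commuting with the embeddings and with the maps to $X$. The category of *innocent strategies* on $X$ is the category $\mathsf S_X=[\mathbb V_X^{\mathrm{op}},\mathbf{Set}]$ of presheaves on $\mathbb V_X$; write $\mathsf S_n=\mathsf S_{[n]}$. **Families.** For a category $\mathcal C$, $\mathrm{Fam}(\mathcal C)$ has as objects the pairs $(Y,p)$ of a set $Y$ and a family $p=(p_y)_{y\in Y}$ of objects of $\mathcal C$; a morphism $(Y,p)\to(Z,q)$ is a map $u\colon Y\to Z$ together with morphisms $v_y\colon p_y\to q_{u(y)}$ of $\mathcal C$ for $y\in Y$. **Theorem (temporal decomposition).** For each $n\in\mathbb N$ there is an equivalence of categories $$\mathsf S_n\;\simeq\;\mathrm{Fam}\Big(\prod_{M\in\mathcal M_n}\mathsf S_{\mathrm{cod}(M)}\Big).$$ 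-/

import Mathlib

open CategoryTheory CategoryTheory.Limits Opposite

universe u

namespace Innocent

/-! ### The base category -/

/-- The (names of) basic moves `[n] → [n']`, as vertices of the generating graph: tick, left and
right half-forking, channel creation, and output (`iotaPos`) and input (`iotaNeg`) on one of the
`n` known channels.  Only channel creation changes the number of known channels. -/
inductive BasicVertex : ℕ → ℕ → Type
  | tick (n : ℕ) : BasicVertex n n
  | forkL (n : ℕ) : BasicVertex n n
  | forkR (n : ℕ) : BasicVertex n n
  | nu (n : ℕ) : BasicVertex n (n + 1)
  | iotaPos (n : ℕ) (i : Fin n) : BasicVertex n n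
  | iotaNeg (n : ℕ) (i : Fin n) : BasicVertex n n

/-- The `n` channels known before a basic move, seen among the `n'` channels known after it. -/
def BasicVertex.keep : {n n' : ℕ} → BasicVertex n n' → Fin n → Fin n'
  | _, _, .tick _ => id
  | _, _, .forkL _ => id
  | _, _, .forkR _ => id
  | _, _, .nu _ => Fin.castSucc
  | _, _, .iotaPos _ _ => id
  | _, _, .iotaNeg _ _ => id

/-- Vertices of the generating graph: channels `⋆`, players `[n]`, basic moves, forking moves
and synchronisation moves. -/
inductive Vertex : Type
  | star : Vertex
  | player (n : ℕ) : Vertex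
  | basic {n n' : ℕ} (b : BasicVertex n n') : Vertex
  | para (n : ℕ) : Vertex
  | tau (n : ℕ) (i : Fin n) (m : ℕ) (j : Fin m) : Vertex

/-- Edges of the generating graph. -/
inductive Edge : Vertex → Vertex → Type
  | d {n : ℕ} (i : Fin n) : Edge .star (.player n)
  | s {n n' : ℕ} (b : BasicVertex n n') : Edge (.player n) (.basic b)
  | t {n n' : ℕ} (b : BasicVertex n n') : Edge (.player n') (.basic b)
  | l (n : ℕ) : Edge (.basic (.forkL n)) (.para n)
  | r (n : ℕ) : Edge (.basic (.forkR n)) (.para n)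
  | ε (n : ℕ) (i : Fin n) (m : ℕ) (j : Fin m) : Edge (.basic (.iotaPos n i)) (.tau n i m j)
  | ρ (n : ℕ) (i : Fin n) (m : ℕ) (j : Fin m) : Edge (.basic (.iotaNeg m j)) (.tau n i m j)

instance : Quiver.{0} Vertex := ⟨Edge⟩

/-- An edge of the generating graph, as a morphism of the free category. -/
def Edge.path {a b : Vertex} (e : Edge a b) : (Paths.of Vertex).obj a ⟶ (Paths.of Vertex).obj b :=
  (Paths.of Vertex).map e

/-- The relations (composition is written in diagrammatic order):
`s ∘ dᵢ = t ∘ dᵢ`, `l ∘ s = r ∘ s` and `ε ∘ s ∘ dᵢ = ρ ∘ s ∘ dⱼ`. -/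
inductive Rel : HomRel (Paths Vertex)
  | channel {n n' : ℕ} (b : BasicVertex n n') (i : Fin n) :
      Rel ((Edge.d i).path ≫ (Edge.s b).path) ((Edge.d (b.keep i)).path ≫ (Edge.t b).path)
  | fork (n : ℕ) :
      Rel ((Edge.s (.forkL n)).path ≫ (Edge.l n).path) ((Edge.s (.forkR n)).path ≫ (Edge.r n).path)
  | sync (n : ℕ) (i : Fin n) (m : ℕ) (j : Fin m) :
      Rel ((Edge.d i).path ≫ (Edge.s (.iotaPos n i)).path ≫ (Edge.ε n i m j).path)
        ((Edge.d j).path ≫ (Edge.s (.iotaNeg m j)).path ≫ (Edge.ρ n i m j).path)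

/-- The base category `ℂ`: generated by the graph above, subject to the relations above. -/
abbrev Base : Type := CategoryTheory.Quotient Rel

/-- A vertex as an object of the base category. -/
def Vertex.toBase (a : Vertex) : Base := (Quotient.functor Rel).obj ((Paths.of Vertex).obj a)

/-- An edge as a morphism of the base category. -/
def Edge.toBase {a b : Vertex} (e : Edge a b) : a.toBase ⟶ b.toBase :=
  (Quotient.functor Rel).map e.path

/-- The category `ℂ̂` of diagrams: presheaves (of sets) on the base category. -/
abbrev Diagram : Type 1 := Baseᵒᵖ ⥤ Type

/-- The representable presheaf on a vertex. -/
abbrev rep (a : Vertex) : Diagram := yoneda.obj a.toBase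

/-- The morphism of representable presheaves induced by an edge. -/
abbrev repMap {a b : Vertex} (e : Edge a b) : rep a ⟶ rep b := yoneda.map e.toBase

/-- Positions: finite presheaves that are empty except over channels and players. -/
def IsPosition (Z : Diagram) : Prop :=
  Finite (Σ a : Vertex, Z.obj (op a.toBase)) ∧
    ∀ a : Vertex, a ≠ .star → (∀ n, a ≠ .player n) → IsEmpty (Z.obj (op a.toBase))

/-! ### Basic moves, interfaces, and extended basic moves -/

/-- A basic move `[n] → [n']`: a cospan `[n] → M ← [n']` of diagrams which is isomorphic, as a
cospan, to one of the chosen cospans `s : [m] → b ← [m'] : t` on representable presheaves. -/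
structure BasicMove (n n' : ℕ) where
  M : Diagram
  s : rep (.player n) ⟶ M
  t : rep (.player n') ⟶ M
  isBasic : ∃ (m m' : ℕ) (b : BasicVertex m m'),
    Nonempty (cospan s t ≅ cospan (repMap (.s b)) (repMap (.t b)))

/-- Isomorphism of basic moves is isomorphism of cospans of diagrams. -/
instance BasicMove.setoid (n n' : ℕ) : Setoid (BasicMove n n') where
  r A B := Nonempty (cospan A.s A.t ≅ cospan B.s B.t)
  iseqv := ⟨fun _ => ⟨Iso.refl _⟩, fun ⟨e⟩ => ⟨e.symm⟩, fun ⟨e⟩ ⟨f⟩ => ⟨e ≪≫ f⟩⟩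

/-- The set `𝓜ₙ` of isomorphism classes of basic moves out of `[n]`. -/
def MoveClass (n : ℕ) : Type 1 := Σ n' : ℕ, _root_.Quotient (BasicMove.setoid n n')

/-- The number of channels known to the final player of a (class of) basic move. -/
def MoveClass.cod {n : ℕ} (M : MoveClass n) : ℕ := M.1

/-- The interface `n · ⋆` of a basic move by a player knowing `n` channels. -/
noncomputable def interface (n : ℕ) : Diagram := ∐ fun _ : Fin n => rep .star

/-- The leg `n · ⋆ → [n]` of the interface of a basic move. -/
noncomputable def interfaceS (n : ℕ) : interface n ⟶ rep (.player n) :=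
  Sigma.desc fun i => repMap (.d i)

/-- The leg `n · ⋆ → [n']` of the interface of a basic move. -/
noncomputable def interfaceT {n n' : ℕ} (b : BasicVertex n n') :
    interface n ⟶ rep (.player n') :=
  Sigma.desc fun i => repMap (.d (b.keep i))

/-- The cospan `X' → M' ← Y'` is an extended basic move: it is obtained from a basic move with its
interface by pushing out along a context `c : n · ⋆ → Z`, where `Z` is a position. -/
def IsExtendedBasicMove {X' M' Y' : Diagram} (s' : X' ⟶ M') (t' : Y' ⟶ M') : Prop :=
  ∃ (n n' : ℕ) (b : BasicVertex n n') (Z : Diagram) (_ : IsPosition Z) (c : interface n ⟶ Z)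
    (x : rep (.player n) ⟶ X') (m : rep (.basic b) ⟶ M') (y : rep (.player n') ⟶ Y')
    (zX : Z ⟶ X') (zM : Z ⟶ M') (zY : Z ⟶ Y'),
    IsPushout (interfaceS n) c x zX ∧
    IsPushout (interfaceS n ≫ repMap (.s b)) c m zM ∧
    IsPushout (interfaceT b) c y zY ∧
    x ≫ s' = repMap (.s b) ≫ m ∧ zX ≫ s' = zM ∧
    y ≫ t' = repMap (.t b) ≫ m ∧ zY ≫ t' = zM

/-! ### Views and innocent strategies -/

/-- The cospan `X → U ← Y` is a finite, possibly empty, composite of extended basic moves in the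
bicategory of cospans of diagrams (composition is by pushout). -/
inductive IsBasicComposite : {X U Y : Diagram} → (X ⟶ U) → (Y ⟶ U) → Prop
  | id (X : Diagram) : IsBasicComposite (𝟙 X) (𝟙 X)
  | comp {X M Y U W Z : Diagram} {s : X ⟶ M} {t : Y ⟶ M} {f : Y ⟶ U} {g : Z ⟶ U}
      {i : M ⟶ W} {j : U ⟶ W} : IsExtendedBasicMove s t → IsBasicComposite f g →
      IsPushout t f i j → IsBasicComposite (s ≫ i) (g ≫ j)

/-- A view is an embedding `Y ↪ U` which is isomorphic to (the initial leg of) a finite composite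
of extended basic moves starting from some `[n]`. -/
def IsView (f : Arrow Diagram) : Prop :=
  Mono f.hom ∧ ∃ (n : ℕ) (U Y : Diagram) (s : rep (.player n) ⟶ U) (t : Y ⟶ U),
    IsBasicComposite s t ∧ Nonempty (f ≅ Arrow.mk s)

/-- The category `𝕍_X` of views over `X`.  Its objects are spans `U ↩ Y → X` where `Y ↪ U` is a
view; its morphisms are pairs `(h : Y → Y', k : U → U')` commuting with the embeddings and with
the morphisms to `X`. -/
abbrev View (X : Diagram) : Type 1 :=
  ObjectProperty.FullSubcategory
    (fun V : CostructuredArrow (Arrow.leftFunc : Arrow Diagram ⥤ Diagram) X => IsView V.left)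

/-- The category `𝖲_X` of innocent strategies on `X`: presheaves of sets on `𝕍_X`. -/
abbrev Strategy (X : Diagram) : Type (max 1 (u + 1)) := (View X)ᵒᵖ ⥤ Type u

/-- The category `𝖲ₙ` of innocent strategies on `[n]`. -/
abbrev StrategyOn (n : ℕ) : Type (max 1 (u + 1)) := Strategy.{u} (rep (.player n))

/-- `Fam 𝒞`: objects are families, indexed by a set, of objects of `𝒞`; a morphism from
`(pᵢ)_{i ∈ I}` to `(qⱼ)_{j ∈ J}` is a map `f : I → J` with morphisms `pᵢ → q_{f i}`. -/
abbrev Fam (𝒞 : Type*) [Category* 𝒞] := FormalCoproduct.{u} 𝒞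

end Innocent

namespace Innocent

/-! ### Morphisms of the base category -/

/-! A view on `[n]` is determined by the sequence of basic moves it composes, so views on `[n]` are
equivalent to the words `Word n` ordered by prefix (`wordEquivalence`). These words form a tree: the
empty word is initial, and the others split by their first move `b` into copies of `Word n'`. A
presheaf on words is thus a set of initial states together with, for each state `y` and move `b`,
the presheaf of elements over words starting with `b` that restrict to `y`. This is an object of the
family category (`decompose`, inverted by `glued`).

The work lies in the comparison with words. A player has no endomorphism but the identity, and basic
moves map to each other only by identities. Pushouts of presheaves along monomorphisms are also
pullbacks, so the initial player of a nonempty word is not in its tail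
(`Word.initial_ne_comp_tail`). Hence a map of composites fixing the initial player matches moves one
by one (`Word.exists_eq_map`). Conversely, an extended move starting from a player has trivial
context (`IsExtendedBasicMove.exists_iso`), so every view comes from a word. -/

theorem exists_path {a b : Vertex} (f : a.toBase ⟶ b.toBase) :
    ∃ p : Quiver.Path a b, f = (Quotient.functor Rel).map (X := (Paths.of Vertex).obj a)
      (Y := (Paths.of Vertex).obj b) p := by
  obtain ⟨p, hp⟩ := (Quotient.functor Rel).map_surjective
    (X := (Paths.of Vertex).obj a) (Y := (Paths.of Vertex).obj b) f
  exact ⟨p, hp.symm⟩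

theorem functor_map_cons {a b c : Vertex} (p : Quiver.Path a b) (e : Edge b c) :
    (Quotient.functor Rel).map (X := (Paths.of Vertex).obj a) (Y := (Paths.of Vertex).obj c)
      (p.cons e) = (Quotient.functor Rel).map (X := (Paths.of Vertex).obj a)
      (Y := (Paths.of Vertex).obj b) p ≫ e.toBase :=
  (Quotient.functor Rel).map_comp (X := (Paths.of Vertex).obj a) (Y := (Paths.of Vertex).obj b)
    (Z := (Paths.of Vertex).obj c) p e.path

theorem functor_map_nil (a : Vertex) :
    (Quotient.functor Rel).map (X := (Paths.of Vertex).obj a) (Y := (Paths.of Vertex).obj a)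
      (Quiver.Path.nil : Quiver.Path a a) = 𝟙 a.toBase :=
  (Quotient.functor Rel).map_id _

/-- A morphism of the base category is an identity or factors through an edge into its target. -/
theorem hom_cases {a b : Vertex} (f : a.toBase ⟶ b.toBase) :
    (∃ h : a = b, f = eqToHom (by rw [h])) ∨
      ∃ (c : Vertex) (g : a.toBase ⟶ c.toBase) (e : Edge c b), f = g ≫ e.toBase := by
  obtain ⟨p, rfl⟩ := exists_path f
  cases p with
  | nil => exact .inl ⟨rfl, functor_map_nil a⟩
  | cons p e => exact .inr ⟨_, _, e, functor_map_cons p e⟩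

theorem hom_star {a : Vertex} (f : a.toBase ⟶ Vertex.star.toBase) :
    ∃ h : a = .star, f = eqToHom (by rw [h]) := by
  obtain h | ⟨c, g, e, -⟩ := hom_cases f
  · exact h
  · cases e

theorem hom_player {a : Vertex} {n : ℕ} (f : a.toBase ⟶ (Vertex.player n).toBase) :
    (∃ h : a = .player n, f = eqToHom (by rw [h])) ∨
      ∃ (h : a = .star) (i : Fin n), f = eqToHom (by rw [h]) ≫ (Edge.d i).toBase := by
  obtain h | ⟨c, g, e, rfl⟩ := hom_cases f
  · exact .inl h
  · cases e with
    | d i =>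
      obtain ⟨rfl, rfl⟩ := hom_star g
      exact .inr ⟨rfl, i, rfl⟩

theorem hom_basic {a : Vertex} {n n' : ℕ} {b : BasicVertex n n'}
    (f : a.toBase ⟶ (Vertex.basic b).toBase) :
    (∃ h : a = .basic b, f = eqToHom (by rw [h])) ∨ a = .star ∨ ∃ m, a = .player m := by
  obtain h | ⟨c, g, e, rfl⟩ := hom_cases f
  · exact .inl h
  · cases e <;> obtain ⟨rfl, -⟩ | ⟨rfl, -⟩ := hom_player g <;> simp

theorem player_hom_player {m n : ℕ} (f : (Vertex.player m).toBase ⟶ (Vertex.player n).toBase) :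
    m = n := by
  obtain ⟨h, -⟩ | ⟨h, -⟩ := hom_player f
  · injection h
  · cases h

theorem player_hom_eq_id {n : ℕ} (f : (Vertex.player n).toBase ⟶ (Vertex.player n).toBase) :
    f = 𝟙 _ := by
  obtain ⟨_, rfl⟩ | ⟨h, -⟩ := hom_player f
  · rfl
  · cases h

theorem not_basic_hom_player {n n' m : ℕ} {b : BasicVertex n n'}
    (f : (Vertex.basic b).toBase ⟶ (Vertex.player m).toBase) : False := by
  obtain ⟨h, -⟩ | ⟨h, -⟩ := hom_player f <;> cases h

theorem basic_hom_basic {n n' m m' : ℕ} {b : BasicVertex n n'} {c : BasicVertex m m'}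
    (f : (Vertex.basic b).toBase ⟶ (Vertex.basic c).toBase) :
    ∃ h : Vertex.basic b = Vertex.basic c, f = eqToHom (by rw [h]) := by
  obtain h | h | ⟨_, h⟩ := hom_basic f
  · exact h
  · cases h
  · cases h

/-! ### Invariants separating morphisms of the base category -/

/-- A functor out of the base category, from an interpretation of its generators. -/
def baseLift (F : Vertex → Type) (φ : ∀ {a b : Vertex}, Edge a b → F a → F b)
    (hchannel : ∀ {n n' : ℕ} (b : BasicVertex n n') (i : Fin n) (x : F .star),
      φ (.s b) (φ (.d i) x) = φ (.t b) (φ (.d (b.keep i)) x))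
    (hfork : ∀ (n : ℕ) (x : F (.player n)), φ (.l n) (φ (.s _) x) = φ (.r n) (φ (.s _) x))
    (hsync : ∀ (n : ℕ) (i : Fin n) (m : ℕ) (j : Fin m) (x : F .star),
      φ (.ε n i m j) (φ (.s _) (φ (.d i) x)) = φ (.ρ n i m j) (φ (.s _) (φ (.d j) x))) :
    Base ⥤ Type :=
  CategoryTheory.Quotient.lift Rel (Paths.lift (C := Type) ⟨F, fun e => TypeCat.ofHom (φ e)⟩) (by
    intro x y f g h
    cases h with
    | channel b i => ext x; exact hchannel b i x
    | fork n => ext x; exact hfork n x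
    | sync n i m j => ext x; exact hsync n i m j x)

@[simp]
theorem baseLift_map (F : Vertex → Type) (φ : ∀ {a b : Vertex}, Edge a b → F a → F b)
    (h₁ h₂ h₃) {a b : Vertex} (e : Edge a b) (x : F a) :
    (baseLift F φ h₁ h₂ h₃).map e.toBase x = φ e x := by
  have := Paths.lift_toPath (C := Type) ⟨F, fun e => TypeCat.ofHom (φ e)⟩ e
  exact ConcreteCategory.congr_hom this x

theorem BasicVertex.keep_injective {n n' : ℕ} (b : BasicVertex n n') :
    Function.Injective b.keep := by
  cases b <;> first | exact Function.injective_id | exact Fin.castSucc_injective _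

/-- The channels known at a vertex after it has been performed. -/
def KnownChannels : Vertex → Type
  | .star => Unit
  | .player n => Fin n
  | @Vertex.basic _ n' _ => Fin n'
  | .para n => Fin n
  | .tau _ _ _ _ => Unit

/-- The action of the edges on known channels. -/
def KnownChannels.map : ∀ {a b : Vertex}, Edge a b → KnownChannels a → KnownChannels b
  | _, _, .d i => fun _ => i
  | _, _, .s b => b.keep
  | _, _, .t _ => id
  | _, _, .l _ => id
  | _, _, .r _ => id
  | _, _, .ε _ _ _ _ => fun _ => ()
  | _, _, .ρ _ _ _ _ => fun _ => ()

/-- The action of the morphisms of the base category on known channels. -/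
def knownMap {a b : Vertex} (f : a.toBase ⟶ b.toBase) : KnownChannels a → KnownChannels b :=
  (baseLift KnownChannels KnownChannels.map (fun _ _ _ => rfl) (fun _ _ => rfl)
    (fun _ _ _ _ _ => rfl)).map f

theorem knownMap_edge {a b : Vertex} (e : Edge a b) :
    knownMap e.toBase = KnownChannels.map e :=
  funext fun x => baseLift_map _ _ _ _ _ e x

theorem knownMap_comp {a b c : Vertex} (f : a.toBase ⟶ b.toBase) (g : b.toBase ⟶ c.toBase) :
    knownMap (f ≫ g) = knownMap g ∘ knownMap f :=
  funext fun x =>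
  ConcreteCategory.congr_hom ((baseLift KnownChannels KnownChannels.map (fun _ _ _ => rfl)
    (fun _ _ => rfl) (fun _ _ _ _ _ => rfl)).map_comp f g) x

/-- The stages (before and after) at which a vertex involves a player. -/
def Stages : Vertex → Type
  | .star => Empty
  | .basic _ => Bool
  | _ => Unit

/-- The action of the edges on stages. -/
def Stages.map : ∀ {a b : Vertex}, Edge a b → Stages a → Stages b
  | _, _, .d _ => Empty.elim
  | _, _, .s _ => fun _ => false
  | _, _, .t _ => fun _ => true
  | _, _, .l _ => fun _ => ()
  | _, _, .r _ => fun _ => ()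
  | _, _, .ε _ _ _ _ => fun _ => ()
  | _, _, .ρ _ _ _ _ => fun _ => ()

/-- The action of the morphisms of the base category on stages. -/
def stagesMap {a b : Vertex} (f : a.toBase ⟶ b.toBase) : Stages a → Stages b :=
  (baseLift Stages Stages.map (fun _ _ x => Empty.elim x) (fun _ _ => rfl)
    (fun _ _ _ _ x => Empty.elim x)).map f

theorem stagesMap_edge {a b : Vertex} (e : Edge a b) : stagesMap e.toBase = Stages.map e :=
  funext fun x => baseLift_map _ _ _ _ _ e x

/-- Known channels cannot tell `s` from `t` when `keep` is the identity; stages can. -/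
theorem s_toBase_ne_t {n : ℕ} (b : BasicVertex n n) : (Edge.s b).toBase ≠ (Edge.t b).toBase := by
  intro h
  have h₁ := congrFun (congrArg stagesMap h) ()
  rw [stagesMap_edge, stagesMap_edge] at h₁
  exact Bool.false_ne_true h₁

theorem d_toBase_injective (n : ℕ) :
    Function.Injective fun i : Fin n => (Edge.d i).toBase := by
  intro i j h
  have h₁ := congrFun (congrArg knownMap h) ()
  dsimp only at h₁
  rwa [knownMap_edge, knownMap_edge] at h₁

/-- The only maps into a player are its identity and the channels `d i`, and the channels are told
apart after composition by their image among known channels. -/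
theorem comp_edge_cancel {n : ℕ} {a z : Vertex} (e : Edge (.player n) a)
    (he : Function.Injective (KnownChannels.map e)) (f g : z.toBase ⟶ (Vertex.player n).toBase)
    (h : f ≫ e.toBase = g ≫ e.toBase) : f = g := by
  obtain ⟨rfl, rfl⟩ | ⟨rfl, i, rfl⟩ := hom_player f
  · exact (player_hom_eq_id g).symm
  · obtain ⟨hz, -⟩ | ⟨_, j, rfl⟩ := hom_player g
    · cases hz
    · simp only [eqToHom_refl, Category.id_comp] at h ⊢
      have h₁ := congrArg knownMap h
      rw [knownMap_comp, knownMap_comp, knownMap_edge, knownMap_edge, knownMap_edge] at h₁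
      rw [show i = j from he (congrFun h₁ ())]

/-- An edge out of a player which is injective on known channels is a monomorphism. -/
theorem mono_toBase {n : ℕ} {a : Vertex} (e : Edge (.player n) a)
    (he : Function.Injective (KnownChannels.map e)) : Mono e.toBase where
  right_cancellation := by
    rintro ⟨z⟩
    exact comp_edge_cancel (z := z) e he

instance mono_s_toBase {n n' : ℕ} (b : BasicVertex n n') : Mono (Edge.s b).toBase :=
  mono_toBase _ b.keep_injective

instance mono_t_toBase {n n' : ℕ} (b : BasicVertex n n') : Mono (Edge.t b).toBase :=
  mono_toBase _ Function.injective_id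

theorem s_comp_channel {n n' : ℕ} (b : BasicVertex n n') (i : Fin n) :
    (Edge.d i).toBase ≫ (Edge.s b).toBase = (Edge.d (b.keep i)).toBase ≫ (Edge.t b).toBase := by
  have := CategoryTheory.Quotient.sound Rel (Rel.channel b i)
  rwa [Functor.map_comp, Functor.map_comp] at this

/-! ### Representables and the interface -/

theorem rep_hom_eq {a b : Vertex} (f : rep a ⟶ rep b) : ∃ g : a.toBase ⟶ b.toBase,
    f = yoneda.map g :=
  ⟨yoneda.preimage f, (yoneda.map_preimage f).symm⟩

theorem rep_player_hom {m n : ℕ} (f : rep (.player m) ⟶ rep (.player n)) : m = n :=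
  player_hom_player (yoneda.preimage f)

theorem rep_player_end {n : ℕ} (f : rep (.player n) ⟶ rep (.player n)) : f = 𝟙 _ := by
  obtain ⟨g, rfl⟩ := rep_hom_eq f
  rw [player_hom_eq_id g, yoneda.map_id]

theorem rep_basic_hom {n n' m m' : ℕ} {b : BasicVertex n n'} {c : BasicVertex m m'}
    (f : rep (.basic b) ⟶ rep (.basic c)) :
    ∃ h : Vertex.basic b = Vertex.basic c, f = eqToHom (by rw [h]) := by
  obtain ⟨g, rfl⟩ := rep_hom_eq f
  obtain ⟨h, rfl⟩ := basic_hom_basic g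
  exact ⟨h, eqToHom_map _ _⟩

instance mono_repMap_s {n n' : ℕ} (b : BasicVertex n n') : Mono (repMap (.s b)) :=
  inferInstanceAs (Mono (yoneda.map _))

instance mono_repMap_t {n n' : ℕ} (b : BasicVertex n n') : Mono (repMap (.t b)) :=
  inferInstanceAs (Mono (yoneda.map _))

/-- Such an `f` forces `n = n'` and is then the identity, so the claim reduces to `s ≠ t`. -/
theorem repMap_s_ne_comp_t {n n' : ℕ} (b : BasicVertex n n')
    (f : rep (.player n) ⟶ rep (.player n')) : repMap (.s b) ≠ f ≫ repMap (.t b) := by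
  intro h
  obtain rfl := rep_player_hom f
  rw [rep_player_end f, Category.id_comp] at h
  exact s_toBase_ne_t b (yoneda.map_injective h)

/-- A map of diagrams is a monomorphism if it is so on maps from representables. -/
theorem mono_of_rep {F G : Diagram} (f : F ⟶ G)
    (h : ∀ (a : Vertex) (x y : rep a ⟶ F), x ≫ f = y ≫ f → x = y) : Mono f where
  right_cancellation {Z} g k hgk := by
    ext ⟨⟨a⟩⟩ z
    obtain ⟨ζ, rfl⟩ := (yonedaEquiv (X := Vertex.toBase a)).surjective z
    have := h a (ζ ≫ g) (ζ ≫ k) (by rw [Category.assoc, Category.assoc, hgk])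
    exact congrArg yonedaEquiv this

/-- The inclusion of a channel in the interface. -/
noncomputable def interfaceι (n : ℕ) (i : Fin n) : rep .star ⟶ interface n :=
  Sigma.ι (fun _ : Fin n => rep .star) i

theorem interface_hom_ext {n : ℕ} {X : Diagram} {f g : interface n ⟶ X}
    (h : ∀ i, interfaceι n i ≫ f = interfaceι n i ≫ g) : f = g :=
  Limits.Sigma.hom_ext _ _ h

theorem interfaceι_comp_S (n : ℕ) (i : Fin n) :
    interfaceι n i ≫ interfaceS n = repMap (.d i) :=
  Limits.Sigma.ι_desc _ _

theorem interfaceι_comp_T {n n' : ℕ} (b : BasicVertex n n') (i : Fin n) :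
    interfaceι n i ≫ interfaceT b = repMap (.d (b.keep i)) :=
  Limits.Sigma.ι_desc _ _

theorem interfaceS_comp_s {n n' : ℕ} (b : BasicVertex n n') :
    interfaceS n ≫ repMap (.s b) = interfaceT b ≫ repMap (.t b) := by
  refine interface_hom_ext fun i => ?_
  rw [← Category.assoc, ← Category.assoc, interfaceι_comp_S, interfaceι_comp_T, repMap, repMap,
    ← yoneda.map_comp, s_comp_channel, yoneda.map_comp]

/-- The elements of the interface are its channels. -/
theorem rep_hom_interface {n : ℕ} {a : Vertex} (x : rep a ⟶ interface n) :
    ∃ (h : a = .star) (i : Fin n), x = eqToHom (by rw [h]) ≫ interfaceι n i := by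
  have hc := isColimitOfPreserves ((evaluation _ _).obj (op a.toBase))
    (coproductIsCoproduct (fun _ : Fin n => rep .star))
  obtain ⟨⟨i⟩, f, hf⟩ := Types.jointly_surjective_of_isColimit hc (yonedaEquiv x)
  have hx : x = yoneda.map f ≫ interfaceι n i := by
    apply yonedaEquiv.injective
    rw [yonedaEquiv_comp, yonedaEquiv_yoneda_map]
    exact hf.symm
  obtain ⟨rfl, rfl⟩ := hom_star f
  exact ⟨rfl, i, hx.trans (by rw [eqToHom_map])⟩

/-- Makes the pushouts along the interface pullbacks as well, which is how contexts are shown to be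
trivial. -/
instance mono_interfaceS (n : ℕ) : Mono (interfaceS n) := by
  refine mono_of_rep _ fun a x y hxy => ?_
  obtain ⟨rfl, i, rfl⟩ := rep_hom_interface x
  obtain ⟨_, j, rfl⟩ := rep_hom_interface y
  rw [eqToHom_refl, Category.id_comp, Category.id_comp, interfaceι_comp_S,
    interfaceι_comp_S] at hxy
  rw [d_toBase_injective n (yoneda.map_injective hxy)]

theorem isPosition_interface (n : ℕ) : IsPosition (interface n) := by
  refine ⟨?_, fun a ha _ => ⟨fun x => ha (rep_hom_interface (yonedaEquiv.symm x)).1⟩⟩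
  refine Finite.of_surjective (fun i : Fin n =>
    (⟨.star, yonedaEquiv (interfaceι n i)⟩ : Σ a : Vertex, (interface n).obj (op a.toBase))) ?_
  rintro ⟨a, x⟩
  obtain ⟨rfl, i, hi⟩ := rep_hom_interface (yonedaEquiv.symm x)
  rw [eqToHom_refl, Category.id_comp, Equiv.symm_apply_eq] at hi
  exact ⟨i, by rw [hi]⟩

/-- An element of a pushout of diagrams comes from one of the legs. -/
theorem rep_hom_pushout {X Y Z W : Diagram} {f : X ⟶ Y} {g : X ⟶ Z} {i : Y ⟶ W} {j : Z ⟶ W}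
    (h : IsPushout f g i j) {a : Vertex} (x : rep a ⟶ W) :
    (∃ y, x = y ≫ i) ∨ ∃ z, x = z ≫ j := by
  obtain ⟨y, hy⟩ | ⟨z, hz⟩ := Types.eq_or_eq_of_isPushout
    (h.map ((evaluation _ _).obj (op a.toBase))) (yonedaEquiv x)
  · refine .inl ⟨yonedaEquiv.symm y, yonedaEquiv.injective ?_⟩
    rw [yonedaEquiv_comp, Equiv.apply_symm_apply]
    exact hy.symm
  · refine .inr ⟨yonedaEquiv.symm z, yonedaEquiv.injective ?_⟩
    rw [yonedaEquiv_comp, Equiv.apply_symm_apply]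
    exact hz.symm

/-! ### Words of basic moves -/

/-- Composable words of basic moves, starting from a player knowing `n` channels. -/
inductive Word : ℕ → Type
  | nil (n : ℕ) : Word n
  | cons {n n' : ℕ} (b : BasicVertex n n') (w : Word n') : Word n

/-- Extensions of words: a proof-relevant form of the prefix ordering. -/
inductive Word.Hom : {n : ℕ} → Word n → Word n → Type
  | nil {n : ℕ} (w : Word n) : Word.Hom (.nil n) w
  | cons {n n' : ℕ} (b : BasicVertex n n') {v w : Word n'} (h : Word.Hom v w) :
      Word.Hom (.cons b v) (.cons b w)

namespace Word

/-- A word is a prefix of another in at most one way, so `Word n` is thin and its coherence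
equations are automatic. -/
theorem Hom.eq {n : ℕ} {v w : Word n} (h h' : Hom v w) : h = h' := by
  induction h with
  | nil w => cases h'; rfl
  | cons b h ih =>
    cases h' with
    | cons _ h' => rw [ih h']

/-- Every word extends itself. -/
def Hom.id : {n : ℕ} → (w : Word n) → Hom w w
  | _, .nil n => .nil _
  | _, .cons b w => .cons b (Hom.id w)

/-- Extensions of words compose. -/
def Hom.comp : {n : ℕ} → {u v w : Word n} → Hom u v → Hom v w → Hom u w
  | _, _, _, _, .nil _, _ => .nil _
  | _, _, _, _, .cons b h, .cons _ h' => .cons b (h.comp h')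

instance (n : ℕ) : Category (Word n) where
  Hom := Hom
  id := Hom.id
  comp := Hom.comp
  id_comp _ := Hom.eq _ _
  comp_id _ := Hom.eq _ _
  assoc _ _ _ := Hom.eq _ _

instance {n : ℕ} (v w : Word n) : Subsingleton (v ⟶ w) := ⟨Hom.eq⟩

/-- The composite of the basic moves in a word, with its initial leg. -/
noncomputable def unfold : {n : ℕ} → Word n → Σ U : Diagram, (rep (.player n) ⟶ U)
  | n, .nil _ => ⟨rep (.player n), 𝟙 _⟩
  | _, .cons b w => ⟨pushout (repMap (.t b)) (unfold w).2,
      repMap (.s b) ≫ pushout.inl (repMap (.t b)) (unfold w).2⟩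

/-- The composite of the basic moves in a word. -/
noncomputable def diagram {n : ℕ} (w : Word n) : Diagram := (unfold w).1

/-- The initial player in the composite of the basic moves in a word. -/
noncomputable def initial {n : ℕ} (w : Word n) : rep (.player n) ⟶ w.diagram := (unfold w).2

/-- The first move in the composite of a nonempty word. -/
noncomputable def head {n n' : ℕ} (b : BasicVertex n n') (w : Word n') :
    rep (.basic b) ⟶ (cons b w).diagram :=
  pushout.inl (repMap (.t b)) w.initial

/-- The remaining moves in the composite of a nonempty word. -/
noncomputable def tail {n n' : ℕ} (b : BasicVertex n n') (w : Word n') :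
    w.diagram ⟶ (cons b w).diagram :=
  pushout.inr (repMap (.t b)) w.initial

theorem isPushout {n n' : ℕ} (b : BasicVertex n n') (w : Word n') :
    IsPushout (repMap (.t b)) w.initial (head b w) (tail b w) :=
  IsPushout.of_hasPushout _ _

theorem initial_cons {n n' : ℕ} (b : BasicVertex n n') (w : Word n') :
    (cons b w).initial = repMap (.s b) ≫ head b w :=
  rfl

instance mono_tail {n n' : ℕ} (b : BasicVertex n n') (w : Word n') : Mono (tail b w) :=
  Adhesive.mono_of_isPushout_of_mono_left (isPushout b w)

instance mono_initial : {n : ℕ} → (w : Word n) → Mono w.initial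
  | n, .nil _ => inferInstanceAs (Mono (𝟙 (rep (.player n))))
  | _, .cons b w => by
    have := mono_initial w
    have : Mono (head b w) := Adhesive.mono_of_isPushout_of_mono_right (isPushout b w)
    rw [initial_cons]
    infer_instance

/-! ### Rigidity of maps between composites -/

/-- The initial player of a nonempty word is not involved in the remaining moves. -/
theorem initial_ne_comp_tail {n n' : ℕ} (b : BasicVertex n n') (w : Word n')
    (z : rep (.player n) ⟶ w.diagram) : (cons b w).initial ≠ z ≫ tail b w := by
  intro h
  have hp := Adhesive.isPullback_of_isPushout_of_mono_left (isPushout b w)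
  exact repMap_s_ne_comp_t b (hp.lift (repMap (.s b)) z h) (hp.lift_fst _ _ h).symm

/-- A map into the composite of a nonempty word that sends the initial player to the remaining
moves factors through them. -/
theorem exists_comp_tail {m n n' : ℕ} (v : Word m) (b : BasicVertex n n') (w : Word n')
    (k : v.diagram ⟶ (cons b w).diagram) (z : rep (.player m) ⟶ w.diagram)
    (hk : v.initial ≫ k = z ≫ tail b w) : ∃ k', k = k' ≫ tail b w ∧ v.initial ≫ k' = z := by
  induction v with
  | nil m => exact ⟨z, (Category.id_comp k).symm.trans hk, Category.id_comp z⟩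
  | cons c v ih =>
    rw [initial_cons, Category.assoc] at hk
    -- If `c` landed in the first move `b`, it would do so by the identity, sending the initial
    -- player to the initial player and not into the tail.
    obtain ⟨y, hy⟩ : ∃ y, head c v ≫ k = y ≫ tail b w := by
      obtain ⟨y, hy⟩ | h := rep_hom_pushout (isPushout b w) (head c v ≫ k)
      · obtain ⟨h, rfl⟩ := rep_basic_hom y
        cases h
        rw [hy, eqToHom_refl, Category.id_comp, ← initial_cons] at hk
        exact (initial_ne_comp_tail b w z hk).elim
      · exact h
    obtain ⟨k', hk', hi⟩ := ih (tail c v ≫ k) (repMap (.t c) ≫ y) (by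
      rw [← Category.assoc, ← (isPushout c v).w, Category.assoc, hy, Category.assoc])
    refine ⟨(isPushout c v).desc y k' hi.symm, (isPushout c v).hom_ext ?_ ?_, ?_⟩
    · rw [← Category.assoc, IsPushout.inl_desc, hy]
    · rw [← Category.assoc, IsPushout.inr_desc, hk']
    · rw [← cancel_mono (tail b w), ← hk, initial_cons, Category.assoc, Category.assoc,
        ← Category.assoc (head c v), IsPushout.inl_desc, hy]

/-- The map between composites induced by an extension of words. -/
noncomputable def Hom.mapAux : {n : ℕ} → {v w : Word n} → Hom v w →
    {k : v.diagram ⟶ w.diagram // v.initial ≫ k = w.initial}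
  | _, _, _, .nil w => ⟨w.initial, Category.id_comp _⟩
  | _, _, _, .cons (v := v) (w := w) b h =>
    ⟨(isPushout b v).desc (head b w) (h.mapAux.1 ≫ tail b w) (by
        rw [← Category.assoc, h.mapAux.2, (isPushout b w).w]), by
      rw [initial_cons, Category.assoc, IsPushout.inl_desc, initial_cons]⟩

/-- The map between composites induced by an extension of words. -/
noncomputable def Hom.map {n : ℕ} {v w : Word n} (h : Hom v w) : v.diagram ⟶ w.diagram :=
  h.mapAux.1

theorem Hom.initial_map {n : ℕ} {v w : Word n} (h : Hom v w) : v.initial ≫ h.map = w.initial :=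
  h.mapAux.2

/-- A map between composites that preserves the initial player is induced by an extension of
words. -/
theorem exists_eq_map {n : ℕ} {v w : Word n} (k : v.diagram ⟶ w.diagram)
    (hk : v.initial ≫ k = w.initial) : ∃ h : Hom v w, k = h.map := by
  induction v with
  | nil n => exact ⟨.nil w, (Category.id_comp k).symm.trans hk⟩
  | cons c v ih =>
    cases w with
    | nil =>
      -- The composite of the empty word is a bare player, which receives no move.
      exact (not_basic_hom_player (yoneda.preimage (Y := (Vertex.player _).toBase)
        (head c v ≫ k))).elim
    | cons b w =>
      rw [initial_cons, Category.assoc] at hk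
      obtain ⟨y, hy⟩ | ⟨z, hz⟩ := rep_hom_pushout (isPushout b w) (head c v ≫ k)
      · obtain ⟨h, rfl⟩ := rep_basic_hom y
        cases h
        rw [eqToHom_refl, Category.id_comp] at hy
        -- The first moves agree, hence so do their final players; the rest of `v` therefore starts
        -- in the tail of the target and stays there.
        obtain ⟨k', hk', hi⟩ := exists_comp_tail v c w (tail c v ≫ k) w.initial (by
          rw [← Category.assoc, ← (isPushout c v).w, Category.assoc, hy, (isPushout c w).w])
        obtain ⟨h, rfl⟩ := ih k' hi
        refine ⟨.cons c h, (isPushout c v).hom_ext ?_ ?_⟩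
        · rw [hy]
          exact ((isPushout c v).inl_desc _ _ _).symm
        · rw [hk']
          exact ((isPushout c v).inr_desc _ _ _).symm
      · rw [hz, ← Category.assoc] at hk
        exact (initial_ne_comp_tail b w _ hk.symm).elim

theorem diagram_hom_ext {n : ℕ} {v w : Word n} {k k' : v.diagram ⟶ w.diagram}
    (hk : v.initial ≫ k = w.initial) (hk' : v.initial ≫ k' = w.initial) : k = k' := by
  obtain ⟨h, rfl⟩ := exists_eq_map k hk
  obtain ⟨h', rfl⟩ := exists_eq_map k' hk'
  rw [h.eq h']

end Word

/-! ### Views are words -/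

/-- Take the interface itself as context, with the identity as context map. -/
theorem isExtendedBasicMove_basic {n n' : ℕ} (b : BasicVertex n n') :
    IsExtendedBasicMove (repMap (.s b)) (repMap (.t b)) := by
  refine ⟨n, n', b, interface n, isPosition_interface n, 𝟙 _, 𝟙 _, 𝟙 _, 𝟙 _, interfaceS n,
    interfaceS n ≫ repMap (.s b), interfaceT b, ?_, ?_, ?_, ?_, rfl, ?_,
    (interfaceS_comp_s b).symm⟩
  · exact IsPushout.of_vert_isIso ⟨by simp⟩
  · exact IsPushout.of_vert_isIso ⟨by simp⟩
  · exact IsPushout.of_vert_isIso ⟨by simp⟩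
  · simp
  · simp

theorem Word.isBasicComposite {n : ℕ} (w : Word n) :
    ∃ (Y : Diagram) (t : Y ⟶ w.diagram), IsBasicComposite w.initial t := by
  induction w with
  | nil n => exact ⟨_, _, .id _⟩
  | cons b w ih =>
    obtain ⟨Y, t, ht⟩ := ih
    exact ⟨Y, _, .comp (isExtendedBasicMove_basic b) ht (Word.isPushout b w)⟩

theorem Word.isView {n : ℕ} (w : Word n) : IsView (Arrow.mk w.initial) := by
  obtain ⟨Y, t, ht⟩ := w.isBasicComposite
  exact ⟨w.mono_initial, n, w.diagram, Y, w.initial, t, ht, ⟨Iso.refl _⟩⟩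

/-- An extended basic move out of a player is a basic move. -/
theorem IsExtendedBasicMove.exists_iso {X M Y : Diagram} {s : X ⟶ M} {t : Y ⟶ M}
    (h : IsExtendedBasicMove s t) {n : ℕ} (e : rep (.player n) ≅ X) :
    ∃ (n' : ℕ) (b : BasicVertex n n') (m : rep (.basic b) ≅ M) (y : rep (.player n') ≅ Y),
      e.hom ≫ s = repMap (.s b) ≫ m.hom ∧ y.hom ≫ t = repMap (.t b) ≫ m.hom := by
  obtain ⟨n₀, n', b, Z, -, c, x, m, y, zX, zM, zY, hX, hM, hY, hs, -, ht, -⟩ := h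
  obtain rfl := rep_player_hom (x ≫ e.inv)
  have hx : x = e.hom := by
    rw [← Iso.comp_inv_eq_id, rep_player_end (x ≫ e.inv)]
  have : IsIso x := by rw [hx]; infer_instance
  -- The square is a pullback, so `c` is a base change of the isomorphism `x`. The other two
  -- pushouts along `c` then change nothing.
  have hp := Adhesive.isPullback_of_isPushout_of_mono_left hX
  have : IsIso c := hp.isIso_snd_of_isIso
  have : IsIso m := hM.isIso_inl_of_isIso
  have : IsIso y := hY.isIso_inl_of_isIso
  exact ⟨n', b, asIso m, asIso y, by rw [← hx]; exact hs, ht⟩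

/-- A composite of extended basic moves out of a player is the composite of a word. -/
theorem IsBasicComposite.exists_word {X U Y : Diagram} {s : X ⟶ U} {t : Y ⟶ U}
    (h : IsBasicComposite s t) : ∀ {n : ℕ} (e : rep (.player n) ≅ X),
      ∃ (w : Word n) (φ : w.diagram ≅ U), w.initial ≫ φ.hom = e.hom ≫ s := by
  induction h with
  | id X => exact fun {n} e => ⟨.nil n, e, by rw [Category.comp_id]; exact Category.id_comp _⟩
  | @comp X M Y U W Z s t f g i j hst _ hp ih =>
    intro n e
    obtain ⟨n', b, m, y, hs, ht⟩ := hst.exists_iso e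
    obtain ⟨w, φ, hw⟩ := ih y
    -- The given pushout, with its first move and its remaining composite replaced by isomorphic
    -- copies.
    have hq : IsPushout (repMap (.t b)) w.initial (m.hom ≫ i) (φ.hom ≫ j) :=
      hp.of_iso y.symm m.symm φ.symm (Iso.refl _)
        (by simp [Iso.comp_inv_eq, ← ht])
        (by simp [Iso.comp_inv_eq, hw]) (by simp) (by simp)
    refine ⟨.cons b w, (Word.isPushout b w).isoIsPushout _ _ hq, ?_⟩
    rw [Word.initial_cons, Category.assoc, IsPushout.inl_isoIsPushout_hom, ← Category.assoc,
      ← Category.assoc, hs]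

/-- The view associated to a word. -/
noncomputable def Word.toView {n : ℕ} (w : Word n) : View (rep (.player n)) :=
  ⟨CostructuredArrow.mk (S := Arrow.leftFunc) (Y := Arrow.mk w.initial) (𝟙 _), w.isView⟩

theorem Word.initial_comp_right {n : ℕ} {v w : Word n} (f : v.toView ⟶ w.toView) :
    v.initial ≫ f.hom.left.right = w.initial := by
  have h : f.hom.left.left = 𝟙 _ := rep_player_end (n := n) _
  refine f.hom.left.w.symm.trans ?_
  rw [h]
  exact Category.id_comp _

instance {n : ℕ} (v w : Word n) : Subsingleton (v.toView ⟶ w.toView) where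
  allEq f g := by
    refine ObjectProperty.hom_ext _ (CostructuredArrow.hom_ext _ _ (CommaMorphism.ext ?_ ?_))
    · exact (rep_player_end (n := n) _).trans (rep_player_end (n := n) _).symm
    · exact Word.diagram_hom_ext (Word.initial_comp_right f) (Word.initial_comp_right g)

/-- Words, as views on a player. -/
noncomputable def wordView (n : ℕ) : Word n ⥤ View (rep (.player n)) where
  obj w := w.toView
  map h := ObjectProperty.homMk (CostructuredArrow.homMk
    (Arrow.homMk (𝟙 _) (Word.Hom.map h)
      ((Category.id_comp _).trans (Word.Hom.initial_map h).symm)) (Category.id_comp _))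
  map_id _ := Subsingleton.elim _ _
  map_comp _ _ := Subsingleton.elim _ _

instance (n : ℕ) : (wordView n).Faithful where
  map_injective _ := Subsingleton.elim _ _

instance (n : ℕ) : (wordView n).Full where
  map_surjective {v w} f := by
    obtain ⟨h, -⟩ := Word.exists_eq_map _ (Word.initial_comp_right f)
    exact ⟨h, Subsingleton.elim (α := v.toView ⟶ w.toView) _ _⟩

instance (n : ℕ) : (wordView n).EssSurj where
  mem_essImage V := by
    obtain ⟨V, -, n', U, Y, s, t, h, ⟨e⟩⟩ := V
    obtain ⟨w, φ, hw⟩ := h.exists_word (Iso.refl _)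
    let e' : Arrow.mk w.initial ≅ V.left :=
      (Arrow.isoMk (Iso.refl _) φ hw.symm : Arrow.mk w.initial ≅ Arrow.mk s) ≪≫ e.symm
    -- The span's leg to `[n]` starts at a copy of `[n']`; this forces `n' = n`, and rigidity of
    -- players makes the leg agree with the identity.
    obtain rfl := rep_player_hom (e'.hom.left ≫ V.hom)
    exact ⟨w, ⟨ObjectProperty.isoMk _ (CostructuredArrow.isoMk e' (rep_player_end _))⟩⟩

/-- The category of views on a player is equivalent to the category of words. -/
noncomputable def wordEquivalence (n : ℕ) : Word n ≌ View (rep (.player n)) :=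
  have : (wordView n).IsEquivalence := {}
  (wordView n).asEquivalence

/-! ### Isomorphism classes of basic moves -/

/-- A basic move vertex, as a basic move. -/
def BasicVertex.toMove {n n' : ℕ} (b : BasicVertex n n') : BasicMove n n' where
  M := rep (.basic b)
  s := repMap (.s b)
  t := repMap (.t b)
  isBasic := ⟨n, n', b, ⟨Iso.refl _⟩⟩

/-- The class of a basic move vertex. -/
def moveClass {n : ℕ} (m : Σ n', BasicVertex n n') : MoveClass n :=
  ⟨m.1, _root_.Quotient.mk _ m.2.toMove⟩

/-- The apex component of a cospan isomorphism is a map between representable basic moves, hence an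
identity. -/
theorem moveClass_injective (n : ℕ) : Function.Injective (moveClass (n := n)) := by
  rintro ⟨n', b⟩ ⟨m', c⟩ h
  obtain ⟨rfl, h⟩ := Sigma.mk.inj_iff.1 h
  obtain ⟨e⟩ := Quotient.exact (eq_of_heq h)
  obtain ⟨h, -⟩ := rep_basic_hom (b := b) (c := c) (e.hom.app WalkingCospan.one)
  cases h
  rfl

theorem moveClass_surjective (n : ℕ) : Function.Surjective (moveClass (n := n)) := by
  rintro ⟨n', ⟨A⟩⟩
  obtain ⟨m, m', b, ⟨e⟩⟩ := A.isBasic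
  obtain rfl : n = m := rep_player_hom (e.hom.app WalkingCospan.left)
  obtain rfl : n' = m' := rep_player_hom (e.hom.app WalkingCospan.right)
  exact ⟨⟨n', b⟩, Sigma.ext rfl (heq_of_eq (Quotient.sound ⟨e.symm⟩))⟩

/-- Basic move vertices represent the classes of basic moves. -/
noncomputable def moveClassEquiv (n : ℕ) : (Σ n', BasicVertex n n') ≃ MoveClass n :=
  Equiv.ofBijective moveClass ⟨moveClass_injective n, moveClass_surjective n⟩

/-! ### Families -/

/-- The action of a functor on families. -/
def famMap {C D : Type*} [Category* C] [Category* D] (F : C ⥤ D) : Fam.{u} C ⥤ Fam.{u} D where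
  obj X := ⟨X.I, fun i => F.obj (X.obj i)⟩
  map f := ⟨f.f, fun i => F.map (f.φ i)⟩
  map_id X := by
    refine FormalCoproduct.hom_ext rfl fun i => ?_
    exact (Category.comp_id _).trans (F.map_id _)
  map_comp f g := by
    refine FormalCoproduct.hom_ext rfl fun i => ?_
    exact (Category.comp_id _).trans (F.map_comp _ _)

instance {C D : Type*} [Category* C] [Category* D] (F : C ⥤ D) [F.Faithful] :
    (famMap.{u} F).Faithful where
  map_injective {X Y f g} h := by
    obtain ⟨f, φ⟩ := f
    obtain ⟨g, ψ⟩ := g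
    obtain ⟨rfl, h⟩ := FormalCoproduct.Hom.mk.inj h
    congr 1
    funext i
    exact F.map_injective (congrFun (eq_of_heq h) i)

instance {C D : Type*} [Category* C] [Category* D] (F : C ⥤ D) [F.Full] :
    (famMap.{u} F).Full where
  map_surjective {X Y} f := ⟨⟨f.f, fun i => F.preimage (f.φ i)⟩, by
    refine FormalCoproduct.hom_ext rfl fun i => ?_
    exact (Category.comp_id _).trans (F.map_preimage _)⟩

instance {C D : Type*} [Category* C] [Category* D] (F : C ⥤ D) [F.EssSurj] :
    (famMap.{u} F).EssSurj where
  mem_essImage Y := ⟨⟨Y.I, fun i => F.objPreimage (Y.obj i)⟩,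
    ⟨FormalCoproduct.isoOfComponents (Equiv.refl _) fun i => F.objObjPreimageIso (Y.obj i)⟩⟩

/-- Equivalent categories have equivalent categories of families. -/
noncomputable def famCongr {C D : Type*} [Category* C] [Category* D] (e : C ≌ D) :
    Fam.{u} C ≌ Fam.{u} D :=
  have : (famMap.{u} e.functor).IsEquivalence := {}
  (famMap.{u} e.functor).asEquivalence

/-! ### Temporal decomposition of presheaves on words -/

/-- Restriction of an element of a presheaf on words to the empty word. -/
def initialState {n : ℕ} (F : (Word n)ᵒᵖ ⥤ Type u) {w : Word n} (z : F.obj (op w)) :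
    F.obj (op (.nil n)) :=
  F.map (Quiver.Hom.op (Word.Hom.nil w : Word.nil n ⟶ w)) z

theorem initialState_nil {n : ℕ} (F : (Word n)ᵒᵖ ⥤ Type u) (z : F.obj (op (.nil n))) :
    initialState F z = z :=
  ConcreteCategory.congr_hom (F.map_id _) z

theorem initialState_map {n : ℕ} (F : (Word n)ᵒᵖ ⥤ Type u) {v w : Word n} (f : v ⟶ w)
    (z : F.obj (op w)) : initialState F (F.map f.op z) = initialState F z :=
  (ConcreteCategory.congr_hom (F.map_comp f.op
    (Quiver.Hom.op (Word.Hom.nil v : Word.nil n ⟶ v))) z).symm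

theorem app_initialState {n : ℕ} {F G : (Word n)ᵒᵖ ⥤ Type u} (α : F ⟶ G) {w : Word n}
    (z : F.obj (op w)) :
    initialState G (α.app _ z) = α.app _ (initialState F z) :=
  (ConcreteCategory.congr_hom (α.naturality
    (Quiver.Hom.op (Word.Hom.nil w : Word.nil n ⟶ w))) z).symm

/-- Prefixing by a basic move. -/
def consFunctor {n n' : ℕ} (b : BasicVertex n n') : Word n' ⥤ Word n where
  obj w := .cons b w
  map h := Word.Hom.cons b h

/-- The residual of a presheaf on words after an initial state and a basic move. -/
def residual {n n' : ℕ} (F : (Word n)ᵒᵖ ⥤ Type u) (y : F.obj (op (.nil n)))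
    (b : BasicVertex n n') : (Word n')ᵒᵖ ⥤ Type u where
  obj w := {z : F.obj (op (.cons b w.unop)) // initialState F z = y}
  map f := TypeCat.ofHom fun z => ⟨F.map ((consFunctor b).map f.unop).op z.1,
    (initialState_map F _ _).trans z.2⟩
  map_id _ := ConcreteCategory.hom_ext _ _ fun z =>
    Subtype.ext (ConcreteCategory.congr_hom (F.map_id _) z.1)
  map_comp f g := ConcreteCategory.hom_ext _ _ fun z =>
    Subtype.ext (ConcreteCategory.congr_hom (F.map_comp
      ((consFunctor b).map f.unop).op ((consFunctor b).map g.unop).op) z.1)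

/-- The category of families of presheaves after each basic move. -/
abbrev Residuals (n : ℕ) : Type (u + 1) :=
  Fam.{u, u, u + 1} (∀ m : Σ n', BasicVertex n n', (Word m.1)ᵒᵖ ⥤ Type u)

/-- A presheaf on words, as the family of its residuals. -/
def decompose (n : ℕ) : ((Word n)ᵒᵖ ⥤ Type u) ⥤ Residuals.{u} n where
  obj F := ⟨F.obj (op (.nil n)), fun y m => residual F y m.2⟩
  map {F G} α := ⟨fun y => α.app _ y, fun y m =>
    { app w := TypeCat.ofHom fun z => ⟨α.app _ z.1, by rw [app_initialState, z.2]⟩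
      naturality _ _ f := ConcreteCategory.hom_ext _ _ fun z =>
        Subtype.ext (ConcreteCategory.congr_hom
          (α.naturality ((consFunctor m.2).map f.unop).op) z.1) }⟩
  map_id F := by
    refine FormalCoproduct.hom_ext rfl fun i => ?_
    exact Category.comp_id _
  map_comp f g := by
    refine FormalCoproduct.hom_ext rfl fun i => ?_
    exact Category.comp_id _

/-! ### Full faithfulness of the decomposition -/

section

variable {n : ℕ} {F G : (Word n)ᵒᵖ ⥤ Type u} (f : (decompose.{u} n).obj F ⟶ (decompose.{u} n).obj G)

/-- The action of a morphism between families of residuals on the elements of the presheaf. -/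
def recomposeApp : (w : Word n) → F.obj (op w) → G.obj (op w)
  | .nil _, y => f.f y
  | .cons b w, z => ((f.φ (initialState F z) ⟨_, b⟩).app (op w) ⟨z, rfl⟩).1

/-- Allows the state `y` to be any element equal to `initialState F z`, since the component `f.φ y`
depends on it. -/
theorem recomposeApp_cons {n' : ℕ} (b : BasicVertex n n') (w : Word n')
    (y : F.obj (op (.nil n))) (z : F.obj (op (.cons b w))) (hz : initialState F z = y) :
    recomposeApp f (.cons b w) z = ((f.φ y ⟨_, b⟩).app (op w) ⟨z, hz⟩).1 := by
  subst hz
  rfl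

theorem initialState_recomposeApp : (w : Word n) → (z : F.obj (op w)) →
    initialState G (recomposeApp f w z) = f.f (initialState F z)
  | .nil _, z => by rw [initialState_nil, initialState_nil]; rfl
  | .cons b w, z => ((f.φ (initialState F z) ⟨_, b⟩).app (op w) ⟨z, rfl⟩).2

/-- A morphism between families of residuals comes from a morphism of presheaves. -/
def recompose : F ⟶ G where
  app w := TypeCat.ofHom (recomposeApp f w.unop)
  naturality := by
    rintro ⟨w⟩ ⟨v⟩ ⟨h⟩
    ext z
    change recomposeApp f v (F.map (Quiver.Hom.op h) z) =
      G.map (Quiver.Hom.op h) (recomposeApp f w z)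
    change Word.Hom v w at h
    cases h with
    | nil w => exact (initialState_recomposeApp f w z).symm
    | @cons _ n' b v w h =>
      -- Restriction preserves the initial state, so both sides use the same component and its
      -- naturality suffices.
      rw [recomposeApp_cons f b v (initialState F z) _ (initialState_map F _ z)]
      exact congrArg Subtype.val (ConcreteCategory.congr_hom
        ((f.φ (initialState F z) ⟨_, b⟩).naturality (Quiver.Hom.op (X := v) (Y := w) h)) ⟨z, rfl⟩)

theorem decompose_map_recompose : (decompose.{u} n).map (recompose f) = f := by
  refine FormalCoproduct.hom_ext rfl fun y => ?_
  refine (Category.comp_id _).trans ?_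
  funext m
  ext w z
  exact Subtype.ext (recomposeApp_cons f m.2 w.unop y z.1 z.2)

end

theorem recompose_decompose_map {n : ℕ} {F G : (Word n)ᵒᵖ ⥤ Type u} (α : F ⟶ G) :
    recompose ((decompose.{u} n).map α) = α := by
  ext ⟨w⟩ z
  cases w <;> rfl

instance (n : ℕ) : (decompose.{u} n).Faithful where
  map_injective {_ _ α β} h := by
    rw [← recompose_decompose_map α, h, recompose_decompose_map]

instance (n : ℕ) : (decompose.{u} n).Full where
  map_surjective f := ⟨recompose f, decompose_map_recompose f⟩

/-! ### Essential surjectivity by gluing -/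

section

variable {n : ℕ} (X : Residuals.{u} n)

/-- The elements over a word of the presheaf with given residuals. -/
def GluedObj : Word n → Type u
  | .nil _ => X.I
  | @Word.cons _ n' b w => Σ i : X.I, (X.obj i ⟨n', b⟩).obj (op w)

/-- Restriction of the elements of the presheaf with given residuals. -/
def gluedMap : {v w : Word n} → Word.Hom v w → GluedObj X w → GluedObj X v
  | _, .nil _, .nil _, i => i
  | _, .cons _ _, .nil _, z => z.1
  | _, _, .cons (v := v) (w := w) b h, z =>
    ⟨z.1, (X.obj z.1 ⟨_, b⟩).map (Quiver.Hom.op (X := v) (Y := w) h) z.2⟩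

/-- The presheaf with given residuals. -/
def glued : (Word n)ᵒᵖ ⥤ Type u where
  obj w := GluedObj X w.unop
  map h := TypeCat.ofHom (gluedMap X h.unop)
  map_id := by
    rintro ⟨w⟩
    ext z
    cases w with
    | nil => rfl
    | @cons _ n' b w =>
      exact congrArg (Sigma.mk z.1)
        (ConcreteCategory.congr_hom ((X.obj z.1 ⟨n', b⟩).map_id (op w)) z.2)
  map_comp := by
    rintro ⟨w⟩ ⟨v⟩ ⟨u⟩ ⟨h⟩ ⟨h'⟩
    ext z
    change Word.Hom v w at h
    change Word.Hom u v at h'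
    cases h' with
    | nil v =>
      cases h with
      | nil w => cases w <;> rfl
      | cons b h => rfl
    | @cons _ n' b u v h' =>
      cases h with
      | @cons _ _ _ _ w h =>
        exact congrArg (Sigma.mk z.1) (ConcreteCategory.congr_hom
          ((X.obj z.1 ⟨n', b⟩).map_comp (Quiver.Hom.op (X := v) (Y := w) h)
            (Quiver.Hom.op (X := u) (Y := v) h')) z.2)

/-- The elements of a fibre of a sum. -/
def sigmaFibreEquiv {I : Type u} (P : I → Type u) (i : I) : {z : Σ j, P j // z.1 = i} ≃ P i where
  toFun z := z.2 ▸ z.1.2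
  invFun x := ⟨⟨i, x⟩, rfl⟩
  left_inv := by rintro ⟨⟨j, x⟩, rfl⟩; rfl
  right_inv _ := rfl

/-- The residuals of a glued presheaf. -/
def residualGluedIso {n' : ℕ} (i : X.I) (b : BasicVertex n n') :
    residual (glued X) i b ≅ X.obj i ⟨n', b⟩ :=
  NatIso.ofComponents
    (fun w => (sigmaFibreEquiv (fun j => (X.obj j ⟨n', b⟩).obj w) i).toIso) (by
      intro v w f
      ext z
      obtain ⟨⟨j, x⟩, h⟩ := z
      cases h
      rfl)

end

/-- Over the empty word the glued presheaf is the index set itself, so only the residuals have to be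
compared. -/
instance (n : ℕ) : (decompose.{u} n).EssSurj where
  mem_essImage X := ⟨glued X, ⟨FormalCoproduct.isoOfComponents (Equiv.refl _)
    fun i => Pi.isoMk fun m => residualGluedIso X i m.2⟩⟩

/-- A presheaf on words is a family of presheaves after each basic move. -/
noncomputable def decomposeEquivalence (n : ℕ) : ((Word n)ᵒᵖ ⥤ Type u) ≌ Residuals.{u} n :=
  have : (decompose.{u} n).IsEquivalence := {}
  (decompose.{u} n).asEquivalence

/-- Strategies are presheaves on words. -/
noncomputable def strategyEquivalence (n : ℕ) : StrategyOn.{u} n ≌ ((Word n)ᵒᵖ ⥤ Type u) :=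
  (wordEquivalence n).op.symm.congrLeft

/-- Families of strategies indexed by classes of moves, as families of presheaves on words. -/
noncomputable def residualsEquivalence (n : ℕ) :
    (∀ M : MoveClass n, StrategyOn.{u} M.cod) ≌
      ∀ m : Σ n', BasicVertex n n', (Word m.1)ᵒᵖ ⥤ Type u :=
  (Pi.equivalenceOfEquiv (fun M : MoveClass n => StrategyOn.{u} M.cod)
    (moveClassEquiv n)).symm.trans
    -- The codomain of the class of `m` is `m.1` by definition, so the factors match without
    -- transport.
    (Equivalence.pi fun m => strategyEquivalence.{u} m.1)

end Innocent

theorem mainTheorem1 (n : ℕ) :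
    Nonempty (Innocent.StrategyOn.{u} n ≌
      Innocent.Fam.{u} (∀ M : Innocent.MoveClass n, Innocent.StrategyOn.{u} M.cod)) :=
  ⟨(Innocent.strategyEquivalence.{u} n).trans ((Innocent.decomposeEquivalence.{u} n).trans
    (Innocent.famCongr.{u} (Innocent.residualsEquivalence.{u} n)).symm)⟩
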